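/- Let $\hbar>0$, let $\rho,B,V\in L^\infty(\mathbb R)$ be real-valued with $\rho\ge\underline\rho>0$, $B\ge\underline B>0$, and let $\rho=\rho_\infty$, $B=B_\infty$, $V=V_\infty$ be constant for $|x|\ge X_0>0$. Let $\Omega=(-X,X)$ with $X>X_0$, and \[ \mathcal L_I(w,\varphi)=\tfrac{\hbar^2}{2}(BDw,D\varphi)_{L^2(I)}+(Vw,\varphi)_{L^2(I)} . \] Let $\ldots<x_{-J}=-X<x_{-J+1}<\ldots<x_J=X<\ldots$ be a mesh on $\mathbb R$ with $x_{-J+1}\le -X_0$, $x_{J-1}\ge X_0$ and $x_j-x_{j-1}=h$ for $j\le -J+1$ or $j\ge J$. For $n\ge1$ let $H_h^{(n)}$ be the space of continuous functions on $\overline\Omega$ that are complex polynomials of degree at most $n$ on each $[x_{j-1},x_j]$, $-J<j\le J$. Let $T>0$, $M\ge1$, $\tau=T/M$, $\overline\partial_tY^m=(Y^m-Y^{m-1})/\tau$, $\overline s_tY^m=(Y^{m-1}+Y^m)/2$. The discrete transparent boundary operator is the discrete convolution $\mathcal S^m\Phi=\sum_{l=0}^m\kappa^l\Phi^{m-l}$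 whose kernel is given by the exterior problem, as follows. Let $E$ be the space of functions in $H^1(0,\infty)$ that are complex polynomials of degree at most $n$ on each $[(j-1)h,jh]$, $j\ge1$. Let $W^m\in E$, $m\ge0$, with $W^0=0$, $W^1(0)=1$, $W^m(0)=0$ for $m\ge2$, be the Crank–Nicolson solution with the constant coefficients $\rho_\infty,B_\infty,V_\infty$; that is, for all $m\ge1$ and $\varphi\in E$, \[ i\hbar(\rho_\infty\overline\partial_tW^m,\varphi)_{L^2(0,\infty)}=\tfrac{\hbar^2}{2}B_\infty(D\overline s_tW^m,D\varphi)_{L^2(0,\infty)}+V_\infty(\overline s_tW^m,\varphi)_{L^2(0,\infty)}+\tfrac{\hbar^2}{2}B_\infty\kappa^{m-1}\varphi^*(0). \] Let $F^m\in L^2(\Omega)$ for $1\le m\le M$, and let $\Psi^0,\dots,\Psi^M\in H_h^{(n)}$ with $\Psi^0(\pm X)=0$ satisfy, for all $\varphi\in H_h^{(n)}$ and $1\le m\le M$, \[ i\hbar(\rho\overline\partial_t\Psi^m,\varphi)_{L^2(\Omega)}=\mathcal L_\Omega(\overline s_t\Psi^m,\varphi)-\tfrac{\hbar^2}{2}B_\infty\bigl(\mathcal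 S^m\{\Psi^l(X)\}_{l=0}^m\bigr)\varphi^*(X)-\tfrac{\hbar^2}{2}B_\infty\bigl(\mathcal S^m\{\Psi^l(-X)\}_{l=0}^m\bigr)\varphi^*(-X)+(F^m,\varphi)_{L^2(\Omega)} . \] Then \[ \max_{0\le m\le M}\|\sqrt\rho\,\Psi^m\|_{L^2(\Omega)}\le\|\sqrt\rho\,\Psi^0\|_{L^2(\Omega)}+\frac2\hbar\sum_{m=1}^M\Bigl\|\frac{F^m}{\sqrt\rho}\Bigr\|_{L^2(\Omega)}\tau . \] -/

import Mathlib

open MeasureTheory Set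
open scoped ComplexConjugate

noncomputable section

namespace SchrodingerFEM

/-- The `L²(I)` pairing `(f, g)_{L²(I)}`, linear in `f` and conjugate linear in `g`. -/
def l2pair (I : Set ℝ) (f g : ℝ → ℂ) : ℂ := ∫ x in I, f x * conj (g x)

/-- The norm of `L²(I)`. -/
def l2norm (I : Set ℝ) (f : ℝ → ℂ) : ℝ := (eLpNorm f 2 (volume.restrict I)).toReal

/-- The finite element space of degree `n` on the open interval `I`, whose closure is the union
of the closed elements `[x (j-1), x j]`, `j ∈ S`: functions of class `H¹(I)` that are on every
element a complex polynomial of degree at most `n`. Being polynomial on closed elements with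
common end points, such a function is continuous, so its weak derivative is its
almost everywhere defined classical derivative, and `H¹(I)` means that both are in `L²(I)`. Only
the values on the closure of `I` matter. -/
def feSpace (n : ℕ) (x : ℤ → ℝ) (S : Set ℤ) (I : Set ℝ) : Set (ℝ → ℂ) :=
  {φ | (∀ j ∈ S, ∃ p : Polynomial ℂ, p.natDegree ≤ n ∧
          ∀ y ∈ Icc (x (j - 1)) (x j), φ y = p.eval (y : ℂ)) ∧
       MemLp φ 2 (volume.restrict I) ∧ MemLp (deriv φ) 2 (volume.restrict I)}

/-- The sesquilinear form `(ħ²/2) (B Dw, Dφ)_{L²(I)} + (V w, φ)_{L²(I)}`. -/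
def energyForm (ħ : ℝ) (B V : ℝ → ℝ) (I : Set ℝ) (w φ : ℝ → ℂ) : ℂ :=
  (ħ : ℂ) ^ 2 / 2 * l2pair I (fun x => (B x : ℂ) * deriv w x) (deriv φ)
    + l2pair I (fun x => (V x : ℂ) * w x) φ

/-- Backward difference quotient in time (used for `m ≥ 1`). -/
def dtBar (τ : ℝ) (Y : ℕ → ℝ → ℂ) (m : ℕ) : ℝ → ℂ :=
  fun x => (Y m x - Y (m - 1) x) / (τ : ℂ)

/-- Mean of two consecutive time levels (used for `m ≥ 1`). -/
def stBar (Y : ℕ → ℝ → ℂ) (m : ℕ) : ℝ → ℂ :=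
  fun x => (Y (m - 1) x + Y m x) / 2

/-- The exterior finite element space: the half-axis `(0, ∞)` with the uniform mesh of step `h`. -/
def extSpace (n : ℕ) (h : ℝ) : Set (ℝ → ℂ) :=
  feSpace n (fun j => (j : ℝ) * h) (Ici 1) (Ioi 0)

/-- `W` is the finite element Crank-Nicolson solution on the half-axis `[0, ∞)`
with constant coefficients, zero initial data and as boundary values at `0`
the unit impulse at time level `1`; and `κ l` is its discrete derivative at `0` (the
coefficient of the boundary term in the integral identity) at time level `l + 1`. -/
structure IsExteriorImpulseResponse (n : ℕ) (ħ ρi Bi Vi h τ : ℝ)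
    (W : ℕ → ℝ → ℂ) (κ : ℕ → ℂ) : Prop where
  mem : ∀ m, W m ∈ extSpace n h
  init : ∀ y, 0 ≤ y → W 0 y = 0
  impulse : ∀ m, W m 0 = if m = 1 then 1 else 0
  eqn : ∀ m, 1 ≤ m → ∀ φ ∈ extSpace n h,
    Complex.I * ħ * l2pair (Ioi 0) (fun x => (ρi : ℂ) * dtBar τ W m x) φ
      = energyForm ħ (fun _ => Bi) (fun _ => Vi) (Ioi 0) (stBar W m) φ
        + (ħ : ℂ) ^ 2 / 2 * Bi * κ (m - 1) * conj (φ 0)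

open Classical in
/-- The convolution kernel of the discrete transparent boundary condition
(including its constant factor). By linearity and invariance under shifts in time,
the exterior solution with zero initial data and boundary values `Φ 0 = 0, Φ 1, Φ 2, …` has the
discrete derivative `∑ l ∈ {0, …, m}, κ l * Φ (m - l)` at the boundary at level `m`. -/
def dtbcKernel (n : ℕ) (ħ ρi Bi Vi h τ : ℝ) : ℕ → ℂ :=
  if H : ∃ κ : ℕ → ℂ, ∃ W : ℕ → ℝ → ℂ, IsExteriorImpulseResponse n ħ ρi Bi Vi h τ W κ
  then H.choose else 0

/-- The discrete convolution operator `𝒮_ref` of the discrete transparent boundary condition. -/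
def dtbcOp (n : ℕ) (ħ ρi Bi Vi h τ : ℝ) (m : ℕ) (Φ : ℕ → ℂ) : ℂ :=
  ∑ l ∈ Finset.range (m + 1), dtbcKernel n ħ ρi Bi Vi h τ l * Φ (m - l)

/-- `Ψ 0, …, Ψ M` solve the finite element Crank-Nicolson scheme on `Ω = (-X, X)`, `X = x J`,
with the discrete transparent boundary conditions at `±X` and
the additional conjugate linear functionals `ℓ 1, …, ℓ M` on the right-hand side. -/
structure IsSchemeSolution (n : ℕ) (ħ : ℝ) (ρ B V : ℝ → ℝ) (ρi Bi Vi : ℝ) (x : ℤ → ℝ) (J : ℤ)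
    (X h τ : ℝ) (M : ℕ) (ℓ : ℕ → (ℝ → ℂ) → ℂ) (Ψ : ℕ → ℝ → ℂ) : Prop where
  mem : ∀ m ≤ M, Ψ m ∈ feSpace n x (Ioc (-J) J) (Ioo (-X) X)
  eqn : ∀ m, 1 ≤ m → m ≤ M → ∀ φ ∈ feSpace n x (Ioc (-J) J) (Ioo (-X) X),
    Complex.I * ħ * l2pair (Ioo (-X) X) (fun y => (ρ y : ℂ) * dtBar τ Ψ m y) φ
      = energyForm ħ B V (Ioo (-X) X) (stBar Ψ m) φ
        - (ħ : ℂ) ^ 2 / 2 * Bi * dtbcOp n ħ ρi Bi Vi h τ m (fun l => Ψ l X) * conj (φ X)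
        - (ħ : ℂ) ^ 2 / 2 * Bi * dtbcOp n ħ ρi Bi Vi h τ m (fun l => Ψ l (-X)) * conj (φ (-X))
        + ℓ m φ

end SchrodingerFEM

end

/-!
# Stability of the Crank–Nicolson finite element scheme with discrete transparent boundaries

The scheme is tested with the time average `sₜΨᵐ` of its own solution, and the imaginary part is
taken. The energy form is real on the diagonal (`energyForm_self_im`), while the time difference
yields `ħ/(2τ)` times the increment of the mass `‖√ρ Ψᵐ‖²` (`re_l2pair_dtBar_stBar`). What is left
are the source, bounded by Cauchy–Schwarz (`abs_im_l2pair_stBar_le`), and the two boundary terms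
`(ħ²/2) B∞ Im (𝒮ᵐΦ · conj (sₜΦᵐ))`, where `Φ` is the sequence of boundary values at `X` or `-X`.

The boundary terms need not have a sign at a single time level, but their sums over time do
(`sum_im_dtbcOp_nonneg`). Superposing time shifts of the impulse response gives an exterior solution
`Y` with zero initial data and boundary values `Φ`, for which `𝒮ᵐΦ` is the discrete derivative at
the boundary (`exteriorSolution_eqn`); this is where `Φ 0 = 0` enters. The same mass balance,
now on the half-axis, shows that the accumulated boundary term is the nonnegative number
`ħ/(2τ) ‖√ρ∞ Yᴺ‖²`: whatever leaves `Ω` is the mass found in the exterior.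

Hence `‖√ρ Ψᵐ‖²` is at most its initial value plus a sum of products of the source with the
solution; at a time level where `‖√ρ Ψᵐ‖` is maximal one factor can be divided out
(`le_add_two_mul_sum_of_sq_le`).
-/

namespace SchrodingerFEM

/-! ### The pairing and the norm of `L²` -/

section L2

variable {I : Set ℝ} {f g : ℝ → ℂ}

lemma l2norm_eq_norm_toLp (hf : MemLp f 2 (volume.restrict I)) :
    l2norm I f = ‖hf.toLp f‖ := (Lp.norm_toLp f hf).symm

lemma l2norm_nonneg (I : Set ℝ) (f : ℝ → ℂ) : 0 ≤ l2norm I f := ENNReal.toReal_nonneg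

lemma l2pair_eq_inner (hf : MemLp f 2 (volume.restrict I)) (hg : MemLp g 2 (volume.restrict I)) :
    l2pair I f g = inner ℂ (hg.toLp g) (hf.toLp f) := by
  rw [L2.inner_def]
  refine integral_congr_ae ?_
  filter_upwards [hf.coeFn_toLp, hg.coeFn_toLp] with y h1 h2
  simp [h1, h2]

lemma norm_l2pair_le (hf : MemLp f 2 (volume.restrict I)) (hg : MemLp g 2 (volume.restrict I)) :
    ‖l2pair I f g‖ ≤ l2norm I f * l2norm I g := by
  rw [l2pair_eq_inner hf hg, l2norm_eq_norm_toLp hf, l2norm_eq_norm_toLp hg, mul_comm]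
  exact norm_inner_le_norm _ _

lemma l2pair_congr {f' g' : ℝ → ℂ} (hf : f =ᵐ[volume.restrict I] f')
    (hg : g =ᵐ[volume.restrict I] g') : l2pair I f g = l2pair I f' g' := by
  refine integral_congr_ae ?_
  filter_upwards [hf, hg] with y h1 h2
  rw [h1, h2]

lemma l2pair_smul (c : ℂ) (f g : ℝ → ℂ) : l2pair I (c • f) g = c * l2pair I f g := by
  simp only [l2pair, Pi.smul_apply, smul_eq_mul, mul_assoc]
  exact integral_const_mul c _

lemma l2pair_sum {ι : Type*} (s : Finset ι) (c : ι → ℂ) (f : ι → ℝ → ℂ)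
    (hf : ∀ i ∈ s, MemLp (f i) 2 (volume.restrict I)) (hg : MemLp g 2 (volume.restrict I)) :
    l2pair I (∑ i ∈ s, c i • f i) g = ∑ i ∈ s, c i * l2pair I (f i) g := by
  have hint : ∀ i ∈ s, Integrable (fun y => (c i • f i) y * conj (g y)) (volume.restrict I) :=
    fun i hi => ((hf i hi).const_smul (c i)).integrable_mul hg.star
  simp_rw [← l2pair_smul]
  unfold l2pair
  rw [← integral_finsetSum s hint]
  simp only [Finset.sum_apply, Finset.sum_mul]

/-- The diagonal of the energy form is real, so it drops out of the imaginary part of the scheme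
tested with its own solution. -/
lemma energyForm_self_im (ħ : ℝ) (B V : ℝ → ℝ) (I : Set ℝ) (w : ℝ → ℂ) :
    (energyForm ħ B V I w w).im = 0 := by
  have key : ∀ (C : ℝ → ℝ) (u : ℝ → ℂ),
      l2pair I (fun y => (C y : ℂ) * u y) u = ((∫ y in I, C y * Complex.normSq (u y) : ℝ) : ℂ) := by
    intro C u
    rw [← integral_complex_ofReal]
    simp only [l2pair, mul_assoc, Complex.mul_conj, Complex.ofReal_mul]
  unfold energyForm
  rw [key B (deriv w), key V w]
  have : (ħ : ℂ) ^ 2 / 2 = ((ħ ^ 2 / 2 : ℝ) : ℂ) := by push_cast; rfl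
  rw [this, ← Complex.ofReal_mul, ← Complex.ofReal_add, Complex.ofReal_im]

end L2

/-! ### The mass balance of a Crank–Nicolson step -/

section Energy

variable {I : Set ℝ} {ρ : ℝ → ℝ} {Y : ℕ → ℝ → ℂ} {τ : ℝ} {m : ℕ}

lemma memLp_sqrt_mul {f : ℝ → ℂ} (hρ : MemLp (fun y => √(ρ y)) ⊤ (volume.restrict I))
    (hf : MemLp f 2 (volume.restrict I)) :
    MemLp (fun y => (√(ρ y) : ℂ) * f y) 2 (volume.restrict I) :=
  hf.mul (hρ.ofReal (K := ℂ))

/-- The Crank–Nicolson pairing telescopes: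
`Re (ρ ∂ₜY, sₜY) = (‖√ρ Yᵐ‖² - ‖√ρ Yᵐ⁻¹‖²) / (2τ)`. -/
lemma re_l2pair_dtBar_stBar (hρ : MemLp (fun y => √(ρ y)) ⊤ (volume.restrict I))
    (hρ0 : ∀ᵐ y ∂volume.restrict I, 0 ≤ ρ y) (hY : MemLp (Y m) 2 (volume.restrict I))
    (hY' : MemLp (Y (m - 1)) 2 (volume.restrict I)) :
    (l2pair I (fun y => (ρ y : ℂ) * dtBar τ Y m y) (stBar Y m)).re
      = (l2norm I (fun y => (√(ρ y) : ℂ) * Y m y) ^ 2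
          - l2norm I (fun y => (√(ρ y) : ℂ) * Y (m - 1) y) ^ 2) / (2 * τ) := by
  have h1 := memLp_sqrt_mul hρ hY
  have h2 := memLp_sqrt_mul hρ hY'
  set u := h1.toLp _ with hu
  set v := h2.toLp _ with hv
  have key : l2pair I (fun y => (ρ y : ℂ) * dtBar τ Y m y) (stBar Y m)
      = ((1 / (2 * τ) : ℝ) : ℂ) * inner ℂ (v + u) (u - v) := by
    rw [hu, hv, ← MemLp.toLp_add, ← MemLp.toLp_sub, ← l2pair_eq_inner, ← l2pair_smul]
    refine integral_congr_ae ?_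
    filter_upwards [hρ0] with y hy
    have hsq : (ρ y : ℂ) = (√(ρ y) : ℂ) * (√(ρ y) : ℂ) := by
      rw [← Complex.ofReal_mul, Real.mul_self_sqrt hy]
    simp only [dtBar, stBar, Pi.smul_apply, Pi.sub_apply, Pi.add_apply, smul_eq_mul, map_div₀,
      map_add, map_mul, Complex.conj_ofReal, hsq]
    push_cast
    simp only [map_ofNat, div_eq_mul_inv, mul_inv]
    ring
  rw [key, Complex.re_ofReal_mul, l2norm_eq_norm_toLp h1, l2norm_eq_norm_toLp h2, ← hu, ← hv,
    inner_add_left, inner_sub_right, inner_sub_right]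
  have e1 : (inner ℂ u u).re = ‖u‖ ^ 2 := inner_self_eq_norm_sq (𝕜 := ℂ) u
  have e2 : (inner ℂ v v).re = ‖v‖ ^ 2 := inner_self_eq_norm_sq (𝕜 := ℂ) v
  have e3 : (inner ℂ v u).re = (inner ℂ u v).re := inner_re_symm (𝕜 := ℂ) v u
  simp only [Complex.add_re, Complex.sub_re, e1, e2, e3]
  ring

end Energy

/-! ### The finite element spaces -/

section Spaces

variable {n : ℕ} {x : ℤ → ℝ} {S : Set ℤ} {I : Set ℝ}

lemma exists_mem_Ioo_of_strictMono (hx : StrictMono x) {a b : ℤ} {y : ℝ} (ha : x a < y)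
    (hb : y < x b) (hy : y ∉ range x) : ∃ j ∈ Ioc a b, y ∈ Ioo (x (j - 1)) (x j) := by
  obtain ⟨j, hj, hmin⟩ := Int.exists_least_of_bdd (P := fun j => y < x j)
    ⟨a, fun j hj => (hx.lt_iff_lt.1 (ha.trans hj)).le⟩ ⟨b, hb⟩
  refine ⟨j, ⟨hx.lt_iff_lt.1 (ha.trans hj), hmin b hb⟩, lt_of_le_of_ne ?_ ?_, hj⟩
  · by_contra hlt
    have := hmin (j - 1) (not_le.1 hlt)
    omega
  · exact fun h => hy ⟨_, h⟩

/-- The interiors of the elements `[x (j-1), x j]`, `j ∈ S`, cover `I` up to a null set. -/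
def MeshCovers (x : ℤ → ℝ) (S : Set ℤ) (I : Set ℝ) : Prop :=
  ∀ᵐ y ∂volume.restrict I, ∃ j ∈ S, y ∈ Ioo (x (j - 1)) (x j)

lemma ae_notMem_range (x : ℤ → ℝ) (I : Set ℝ) : ∀ᵐ y ∂volume.restrict I, y ∉ range x :=
  ae_restrict_of_ae ((countable_range x).ae_notMem volume)

lemma meshCovers_Ioo (hx : StrictMono x) (a b : ℤ) :
    MeshCovers x (Ioc a b) (Ioo (x a) (x b)) := by
  filter_upwards [ae_notMem_range x (Ioo (x a) (x b)), ae_restrict_mem measurableSet_Ioo]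
    with y hy hyI
  exact exists_mem_Ioo_of_strictMono hx hyI.1 hyI.2 hy

lemma meshCovers_Ioi {h : ℝ} (hh : 0 < h) :
    MeshCovers (fun j => (j : ℝ) * h) (Ici 1) (Ioi 0) := by
  have hx : StrictMono (fun j : ℤ => (j : ℝ) * h) := fun i j hij =>
    mul_lt_mul_of_pos_right (Int.cast_lt.2 hij) hh
  filter_upwards [ae_notMem_range (fun j : ℤ => (j : ℝ) * h) (Ioi 0),
    ae_restrict_mem measurableSet_Ioi] with y hy hyI
  obtain ⟨b, hb⟩ := exists_int_gt (y / h)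
  obtain ⟨j, hj, hyj⟩ := exists_mem_Ioo_of_strictMono hx (a := 0) (b := b) (y := y)
    (by simpa using hyI) ((div_lt_iff₀ hh).1 hb) hy
  exact ⟨j, Int.add_one_le_of_lt hj.1, hyj⟩

lemma feSpace.ae_differentiableAt (hc : MeshCovers x S I) {φ : ℝ → ℂ}
    (hφ : φ ∈ feSpace n x S I) : ∀ᵐ y ∂volume.restrict I, DifferentiableAt ℝ φ y := by
  filter_upwards [hc] with y hy
  obtain ⟨j, hj, hyj⟩ := hy
  obtain ⟨p, -, hp⟩ := hφ.1 j hj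
  have hd : DifferentiableAt ℝ (fun y : ℝ => p.eval (y : ℂ)) y :=
    (p.differentiable.differentiableAt.hasDerivAt.comp_ofReal).differentiableAt
  refine hd.congr_of_eventuallyEq ?_
  filter_upwards [isOpen_Ioo.mem_nhds hyj] with z hz
  exact hp z (Ioo_subset_Icc_self hz)

lemma feSpace.deriv_add (hc : MeshCovers x S I) {φ ψ : ℝ → ℂ}
    (hφ : φ ∈ feSpace n x S I) (hψ : ψ ∈ feSpace n x S I) :
    deriv (φ + ψ) =ᵐ[volume.restrict I] deriv φ + deriv ψ := by
  filter_upwards [ae_differentiableAt hc hφ, ae_differentiableAt hc hψ] with y h1 h2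
  exact _root_.deriv_add h1 h2

/-- The finite element space as a vector space. The covering hypothesis makes its elements
differentiable almost everywhere, without which `deriv` need not be additive. -/
def feSubmodule (n : ℕ) (hc : MeshCovers x S I) : Submodule ℂ (ℝ → ℂ) where
  carrier := feSpace n x S I
  add_mem' := by
    intro φ ψ hφ hψ
    refine ⟨fun j hj => ?_, hφ.2.1.add hψ.2.1,
      (memLp_congr_ae (feSpace.deriv_add hc hφ hψ)).2 (hφ.2.2.add hψ.2.2)⟩
    obtain ⟨p, hp, hp'⟩ := hφ.1 j hj
    obtain ⟨q, hq, hq'⟩ := hψ.1 j hj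
    refine ⟨p + q, Polynomial.natDegree_add_le_of_degree_le hp hq, fun y hy => ?_⟩
    rw [Pi.add_apply, hp' y hy, hq' y hy, Polynomial.eval_add]
  zero_mem' := by
    refine ⟨fun j _ => ⟨0, by simp, by simp⟩, MemLp.zero, ?_⟩
    have : deriv (0 : ℝ → ℂ) = 0 := by ext y; exact deriv_const y 0
    rw [this]
    exact MemLp.zero
  smul_mem' := by
    intro c φ hφ
    refine ⟨fun j hj => ?_, hφ.2.1.const_smul c, ?_⟩
    · obtain ⟨p, hp, hp'⟩ := hφ.1 j hj
      refine ⟨c • p, (Polynomial.natDegree_smul_le c p).trans hp, fun y hy => ?_⟩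
      rw [Pi.smul_apply, hp' y hy, Polynomial.eval_smul]
    · have : deriv (c • φ) = c • deriv φ := by ext y; exact deriv_const_smul_field c φ
      rw [this]
      exact hφ.2.2.const_smul c

lemma stBar_mem_feSpace (hc : MeshCovers x S I) {Y : ℕ → ℝ → ℂ} {m : ℕ}
    (h1 : Y (m - 1) ∈ feSpace n x S I) (h2 : Y m ∈ feSpace n x S I) :
    stBar Y m ∈ feSpace n x S I := by
  have h := (feSubmodule n hc).smul_mem (1 / 2) ((feSubmodule n hc).add_mem h1 h2)
  have e : (1 / 2 : ℂ) • (Y (m - 1) + Y m) = stBar Y m := by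
    ext y
    simp only [stBar, Pi.smul_apply, Pi.add_apply, smul_eq_mul]
    ring
  rwa [e] at h

lemma dtBar_mem_feSpace (hc : MeshCovers x S I) {Y : ℕ → ℝ → ℂ} {τ : ℝ} {m : ℕ}
    (h1 : Y (m - 1) ∈ feSpace n x S I) (h2 : Y m ∈ feSpace n x S I) :
    dtBar τ Y m ∈ feSpace n x S I := by
  have h := (feSubmodule n hc).smul_mem ((τ : ℂ)⁻¹) ((feSubmodule n hc).sub_mem h2 h1)
  have e : (τ : ℂ)⁻¹ • (Y m - Y (m - 1)) = dtBar τ Y m := by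
    ext y
    simp only [dtBar, Pi.smul_apply, Pi.sub_apply, smul_eq_mul]
    ring
  rwa [e] at h

lemma sum_smul_mem_feSpace (hc : MeshCovers x S I) {ι : Type*} (s : Finset ι) (c : ι → ℂ)
    (f : ι → ℝ → ℂ) (hf : ∀ i ∈ s, f i ∈ feSpace n x S I) :
    ∑ i ∈ s, c i • f i ∈ feSpace n x S I :=
  (feSubmodule n hc).sum_mem fun i hi => (feSubmodule n hc).smul_mem (c i) (hf i hi)

lemma feSpace.deriv_sum_smul (hc : MeshCovers x S I) {ι : Type*} (s : Finset ι) (c : ι → ℂ)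
    (f : ι → ℝ → ℂ) (hf : ∀ i ∈ s, f i ∈ feSpace n x S I) :
    deriv (∑ i ∈ s, c i • f i) =ᵐ[volume.restrict I] ∑ i ∈ s, c i • deriv (f i) := by
  have h : ∀ᵐ y ∂volume.restrict I, ∀ i ∈ s, DifferentiableAt ℝ (f i) y :=
    (Filter.eventually_all_finset s).2 fun i hi => ae_differentiableAt hc (hf i hi)
  filter_upwards [h] with y hy
  rw [deriv_sum fun i hi => (hy i hi).const_smul (c i), Finset.sum_apply]
  exact Finset.sum_congr rfl fun i _ => deriv_const_smul_field (c i) (f i)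

/-- Linearity of the energy form with constant coefficients in its first argument. -/
lemma energyForm_const_sum (hc : MeshCovers x S I) (ħ b v : ℝ) {ι : Type*} (s : Finset ι)
    (c : ι → ℂ) (f : ι → ℝ → ℂ) (hf : ∀ i ∈ s, f i ∈ feSpace n x S I) {φ : ℝ → ℂ}
    (hφ : φ ∈ feSpace n x S I) :
    energyForm ħ (fun _ => b) (fun _ => v) I (∑ i ∈ s, c i • f i) φ
      = ∑ i ∈ s, c i * energyForm ħ (fun _ => b) (fun _ => v) I (f i) φ := by
  have hsm : ∀ (a : ℂ) (u w : ℝ → ℂ), l2pair I (fun y => a * u y) w = a * l2pair I u w :=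
    fun a u w => l2pair_smul a u w
  simp only [energyForm, hsm]
  rw [l2pair_congr (feSpace.deriv_sum_smul hc s c f hf) (ae_eq_refl _),
    l2pair_sum s c _ (fun i hi => (hf i hi).2.2) hφ.2.2,
    l2pair_sum s c _ (fun i hi => (hf i hi).2.1) hφ.2.1,
    Finset.mul_sum, Finset.mul_sum, Finset.mul_sum, ← Finset.sum_add_distrib]
  exact Finset.sum_congr rfl fun i _ => by ring

lemma energyForm_congr_left {ħ : ℝ} {B V : ℝ → ℝ} (hI : IsOpen I) {w w' : ℝ → ℂ}
    (h : EqOn w w' I) (φ : ℝ → ℂ) : energyForm ħ B V I w φ = energyForm ħ B V I w' φ := by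
  have hd : EqOn (deriv w) (deriv w') I := h.deriv hI
  have hae : ∀ᵐ y ∂volume.restrict I, y ∈ I := ae_restrict_mem hI.measurableSet
  unfold energyForm
  congr 1
  · congr 1
    exact l2pair_congr (hae.mono fun y hy => by simp only [hd hy]) (ae_eq_refl _)
  · exact l2pair_congr (hae.mono fun y hy => by simp only [h hy]) (ae_eq_refl _)

end Spaces

/-! ### Dissipativity of the discrete transparent boundary condition -/

section Exterior

variable {n : ℕ} {ħ ρi Bi Vi h τ : ℝ} {W : ℕ → ℝ → ℂ} {κ : ℕ → ℂ}

/-- The superposition `Yᵐ = ∑ Φᵏ⁺¹ Wᵐ⁻ᵏ` of time shifts of the impulse response `W`, that is, the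
exterior solution with zero initial data and boundary values `0, Φ 1, Φ 2, …`. -/
def exteriorSolution (W : ℕ → ℝ → ℂ) (Φ : ℕ → ℂ) (m : ℕ) : ℝ → ℂ :=
  ∑ k ∈ Finset.range m, Φ (k + 1) • W (m - k)

/-- Since `W 0` vanishes on the half-axis, the preceding time level can be summed over the same
range as the present one. -/
lemma exteriorSolution_pred (hW : IsExteriorImpulseResponse n ħ ρi Bi Vi h τ W κ) (Φ : ℕ → ℂ)
    {m : ℕ} (hm : 1 ≤ m) {y : ℝ} (hy : 0 ≤ y) :
    exteriorSolution W Φ (m - 1) y = ∑ k ∈ Finset.range m, Φ (k + 1) * W (m - k - 1) y := by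
  obtain ⟨p, rfl⟩ := Nat.exists_eq_add_of_le' hm
  rw [Finset.sum_range_succ]
  simp only [exteriorSolution, Finset.sum_apply, Pi.smul_apply, smul_eq_mul, Nat.add_sub_cancel]
  rw [show p + 1 - p - 1 = 0 by omega, hW.init y hy, mul_zero, add_zero]
  refine Finset.sum_congr rfl fun k _ => ?_
  rw [show p + 1 - k - 1 = p - k by omega]

lemma exteriorSolution_apply (W : ℕ → ℝ → ℂ) (Φ : ℕ → ℂ) (m : ℕ) (y : ℝ) :
    exteriorSolution W Φ m y = ∑ k ∈ Finset.range m, Φ (k + 1) * W (m - k) y := by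
  simp [exteriorSolution]

lemma exteriorSolution_zero (hW : IsExteriorImpulseResponse n ħ ρi Bi Vi h τ W κ) {Φ : ℕ → ℂ}
    (hΦ : Φ 0 = 0) (m : ℕ) : exteriorSolution W Φ m 0 = Φ m := by
  rw [exteriorSolution_apply]
  rcases m with _ | p
  · simp [hΦ]
  · rw [Finset.sum_range_succ, Finset.sum_eq_zero, zero_add, hW.impulse, if_pos (by omega), mul_one]
    intro k hk
    rw [hW.impulse, if_neg (by have := Finset.mem_range.1 hk; omega), mul_zero]

lemma exteriorSolution_mem (hh : 0 < h) (hW : IsExteriorImpulseResponse n ħ ρi Bi Vi h τ W κ)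
    (Φ : ℕ → ℂ) (m : ℕ) : exteriorSolution W Φ m ∈ extSpace n h :=
  sum_smul_mem_feSpace (meshCovers_Ioi hh) _ _ _ fun _ _ => hW.mem _

/-- The exterior solution satisfies the Crank–Nicolson identity, the discrete convolution of `κ`
and `Φ` being its discrete derivative at `0`. -/
lemma exteriorSolution_eqn (hh : 0 < h) (hW : IsExteriorImpulseResponse n ħ ρi Bi Vi h τ W κ)
    {Φ : ℕ → ℂ} (hΦ : Φ 0 = 0) {m : ℕ} (hm : 1 ≤ m) {φ : ℝ → ℂ} (hφ : φ ∈ extSpace n h) :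
    Complex.I * ħ * l2pair (Ioi 0)
        (fun y => (ρi : ℂ) * dtBar τ (exteriorSolution W Φ) m y) φ
      = energyForm ħ (fun _ => Bi) (fun _ => Vi) (Ioi 0) (stBar (exteriorSolution W Φ) m) φ
        + (ħ : ℂ) ^ 2 / 2 * Bi * (∑ l ∈ Finset.range (m + 1), κ l * Φ (m - l)) * conj (φ 0) := by
  have hc := meshCovers_Ioi hh
  have hdt : EqOn (dtBar τ (exteriorSolution W Φ) m)
      (∑ k ∈ Finset.range m, Φ (k + 1) • dtBar τ W (m - k)) (Ioi 0) := by
    intro y hy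
    simp only [dtBar, exteriorSolution_pred hW Φ hm (le_of_lt hy), exteriorSolution_apply,
      Finset.sum_apply, Pi.smul_apply, smul_eq_mul]
    rw [← Finset.sum_sub_distrib, Finset.sum_div]
    exact Finset.sum_congr rfl fun k _ => by ring
  have hst : EqOn (stBar (exteriorSolution W Φ) m)
      (∑ k ∈ Finset.range m, Φ (k + 1) • stBar W (m - k)) (Ioi 0) := by
    intro y hy
    simp only [stBar, exteriorSolution_pred hW Φ hm (le_of_lt hy), exteriorSolution_apply,
      Finset.sum_apply, Pi.smul_apply, smul_eq_mul]
    rw [← Finset.sum_add_distrib, Finset.sum_div]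
    exact Finset.sum_congr rfl fun k _ => by ring
  have hconv : ∑ l ∈ Finset.range (m + 1), κ l * Φ (m - l)
      = ∑ k ∈ Finset.range m, Φ (k + 1) * κ (m - k - 1) := by
    rw [← Finset.sum_range_reflect, Finset.sum_range_succ']
    simp only [Nat.add_sub_cancel, Nat.sub_zero, Nat.sub_self, hΦ, mul_zero, add_zero]
    refine Finset.sum_congr rfl fun k hk => ?_
    have := Finset.mem_range.1 hk
    rw [mul_comm, show m - (m - (k + 1)) = k + 1 by omega, Nat.sub_sub]
  have hsm : ∀ u : ℝ → ℂ, l2pair (Ioi 0) (fun y => (ρi : ℂ) * u y) φ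
      = ρi * l2pair (Ioi 0) u φ := fun u => l2pair_smul _ u φ
  rw [energyForm_congr_left isOpen_Ioi hst, energyForm_const_sum hc ħ Bi Vi _ _ _
    (fun i _ => stBar_mem_feSpace hc (hW.mem _) (hW.mem _)) hφ, hconv, hsm,
    l2pair_congr ((ae_restrict_mem measurableSet_Ioi).mono fun y hy => hdt hy) (ae_eq_refl _),
    l2pair_sum _ _ _ (fun i _ => (dtBar_mem_feSpace hc (hW.mem _) (hW.mem _)).2.1) hφ.2.1]
  simp only [Finset.mul_sum, Finset.sum_mul]
  rw [← Finset.sum_add_distrib]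
  refine Finset.sum_congr rfl fun k hk => ?_
  have e := hW.eqn (m - k) (by have := Finset.mem_range.1 hk; omega) φ hφ
  rw [hsm] at e
  linear_combination Φ (k + 1) * e

/-- The boundary terms accumulated up to a time level are a positive multiple of the mass of the
exterior solution at that level. -/
lemma sum_im_conv_nonneg (hħ : 0 < ħ) (hρi : 0 ≤ ρi) (hh : 0 < h) (hτ : 0 < τ)
    (hW : IsExteriorImpulseResponse n ħ ρi Bi Vi h τ W κ) {Φ : ℕ → ℂ} (hΦ : Φ 0 = 0) (N : ℕ) :
    0 ≤ ∑ m ∈ Finset.Icc 1 N, ((ħ : ℂ) ^ 2 / 2 * Bi *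
      (∑ l ∈ Finset.range (m + 1), κ l * Φ (m - l)) * conj ((Φ (m - 1) + Φ m) / 2)).im := by
  have hc := meshCovers_Ioi hh
  have hmem := exteriorSolution_mem hh hW Φ
  set Y := exteriorSolution W Φ with hYdef
  set a : ℕ → ℝ := fun m => l2norm (Ioi 0) (fun y => (√ρi : ℂ) * Y m y) with ha
  have hsqrt : MemLp (fun _ : ℝ => √ρi) ⊤ (volume.restrict (Ioi 0)) := memLp_top_const _
  have step : ∀ m, 1 ≤ m → ((ħ : ℂ) ^ 2 / 2 * Bi *
      (∑ l ∈ Finset.range (m + 1), κ l * Φ (m - l)) * conj ((Φ (m - 1) + Φ m) / 2)).im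
      = ħ / (2 * τ) * (a m ^ 2 - a (m - 1) ^ 2) := by
    intro m hm
    have e := exteriorSolution_eqn hh hW hΦ hm (stBar_mem_feSpace hc (hmem (m - 1)) (hmem m))
    have e0 : stBar Y m 0 = (Φ (m - 1) + Φ m) / 2 := by
      simp only [stBar, hYdef, exteriorSolution_zero hW hΦ]
    have e1 := re_l2pair_dtBar_stBar (ρ := fun _ => ρi) (τ := τ) hsqrt
      (Filter.Eventually.of_forall fun _ => hρi) (hmem m).2.1 (hmem (m - 1)).2.1
    have e2 := congrArg Complex.im e
    rw [Complex.add_im, energyForm_self_im, e0, zero_add, mul_assoc, Complex.I_mul_im,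
      Complex.re_ofReal_mul, e1] at e2
    rw [← e2]
    ring
  rw [Finset.sum_congr rfl fun m hm => step m (Finset.mem_Icc.1 hm).1, ← Finset.mul_sum]
  have hsum : ∀ N, ∑ m ∈ Finset.Icc 1 N, (a m ^ 2 - a (m - 1) ^ 2) = a N ^ 2 - a 0 ^ 2 := by
    intro N
    induction N with
    | zero => simp
    | succ k ih => rw [Finset.sum_Icc_succ_top (by omega), ih, Nat.add_sub_cancel]; ring
  have ha0 : a 0 = 0 := by simp [ha, hYdef, exteriorSolution, l2norm]
  rw [hsum, ha0]
  have := sq_nonneg (a N)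
  have : 0 < ħ / (2 * τ) := by positivity
  nlinarith

/-- The discrete transparent boundary condition is dissipative. The kernel is that of some impulse
response whenever one exists; otherwise it is zero by convention and so is the sum, so that
solvability of the exterior problem is not needed here. -/
lemma sum_im_dtbcOp_nonneg (hħ : 0 < ħ) (hρi : 0 ≤ ρi) (hh : 0 < h) (hτ : 0 < τ) {Φ : ℕ → ℂ}
    (hΦ : Φ 0 = 0) (N : ℕ) :
    0 ≤ ∑ m ∈ Finset.Icc 1 N, ((ħ : ℂ) ^ 2 / 2 * Bi *
      dtbcOp n ħ ρi Bi Vi h τ m Φ * conj ((Φ (m - 1) + Φ m) / 2)).im := by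
  by_cases H : ∃ κ : ℕ → ℂ, ∃ W : ℕ → ℝ → ℂ, IsExteriorImpulseResponse n ħ ρi Bi Vi h τ W κ
  · have hκ : dtbcKernel n ħ ρi Bi Vi h τ = H.choose := by rw [dtbcKernel, dif_pos H]
    obtain ⟨W, hW⟩ := H.choose_spec
    simpa only [dtbcOp, hκ] using sum_im_conv_nonneg hħ hρi hh hτ hW hΦ N
  · simp [dtbcOp, dtbcKernel, dif_neg H]

end Exterior

/-! ### From quadratic increments to a bound of the maximum -/

lemma le_add_two_mul_sum_of_sq_le {a g : ℕ → ℝ} {M : ℕ} (ha : ∀ m, 0 ≤ a m)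
    (hg : ∀ m, 0 ≤ g m)
    (h : ∀ m ≤ M, a m ^ 2 ≤ a 0 ^ 2 + ∑ k ∈ Finset.Icc 1 m, g k * (a (k - 1) + a k)) :
    ∀ m ≤ M, a m ≤ a 0 + 2 * ∑ k ∈ Finset.Icc 1 M, g k := by
  -- At a level `p` where `a` is maximal, one factor `a p` can be divided out.
  obtain ⟨p, hp, hmax⟩ := Finset.exists_max_image (Finset.range (M + 1)) a ⟨0, by simp⟩
  have hpM : p ≤ M := Nat.lt_succ_iff.1 (Finset.mem_range.1 hp)
  have hmax' : ∀ k ≤ M, a k ≤ a p := fun k hk => hmax k (Finset.mem_range.2 (by omega))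
  suffices a p ≤ a 0 + 2 * ∑ k ∈ Finset.Icc 1 M, g k from
    fun m hm => (hmax' m hm).trans this
  have h1 : ∑ k ∈ Finset.Icc 1 p, g k * (a (k - 1) + a k)
      ≤ ∑ k ∈ Finset.Icc 1 p, g k * (2 * a p) := by
    refine Finset.sum_le_sum fun k hk => mul_le_mul_of_nonneg_left ?_ (hg k)
    have := (Finset.mem_Icc.1 hk).2
    linarith [hmax' k (by omega), hmax' (k - 1) (by omega)]
  have h2 : ∑ k ∈ Finset.Icc 1 p, g k ≤ ∑ k ∈ Finset.Icc 1 M, g k :=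
    Finset.sum_le_sum_of_subset_of_nonneg (Finset.Icc_subset_Icc_right hpM) fun k _ _ => hg k
  rw [← Finset.sum_mul] at h1
  have h3 : 0 ≤ ∑ k ∈ Finset.Icc 1 M, g k := Finset.sum_nonneg fun k _ => hg k
  rcases (ha p).eq_or_lt with h0 | h0
  · rw [← h0]; linarith [ha 0]
  · refine le_of_mul_le_mul_right ?_ h0
    nlinarith [h p hpM, hmax' 0 (Nat.zero_le M), ha 0, mul_le_mul_of_nonneg_right h2 h0.le]

/-! ### The stability estimate -/

/-- The source term is controlled by weighted norms, because the weights `1/√ρ` and `√ρ` cancel. -/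
lemma abs_im_l2pair_stBar_le {I : Set ℝ} {ρ : ℝ → ℝ} {ρlow : ℝ} (hρlow : 0 < ρlow)
    (hρ_ge : ∀ᵐ y ∂volume.restrict I, ρlow ≤ ρ y)
    (hρ : MemLp (fun y => √(ρ y)) ⊤ (volume.restrict I)) {F : ℝ → ℂ}
    (hF : MemLp F 2 (volume.restrict I)) {Y : ℕ → ℝ → ℂ} {m : ℕ}
    (hY : MemLp (Y m) 2 (volume.restrict I)) (hY' : MemLp (Y (m - 1)) 2 (volume.restrict I)) :
    |(l2pair I F (stBar Y m)).im| ≤ l2norm I (fun y => F y / (√(ρ y) : ℂ)) *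
      ((l2norm I (fun y => (√(ρ y) : ℂ) * Y (m - 1) y)
        + l2norm I (fun y => (√(ρ y) : ℂ) * Y m y)) / 2) := by
  have h1 := memLp_sqrt_mul hρ hY
  have h2 := memLp_sqrt_mul hρ hY'
  have hFρ : MemLp (fun y => F y / (√(ρ y) : ℂ)) 2 (volume.restrict I) := by
    refine (hF.const_smul ((√ρlow : ℂ)⁻¹)).of_le
      (hF.1.aemeasurable.div (hρ.ofReal (K := ℂ)).1.aemeasurable).aestronglyMeasurable ?_
    filter_upwards [hρ_ge] with y hy
    have hl : 0 < √ρlow := Real.sqrt_pos.2 hρlow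
    rw [Pi.smul_apply, norm_smul, norm_div, norm_inv, Complex.norm_real, Complex.norm_real,
      Real.norm_of_nonneg hl.le, Real.norm_of_nonneg (Real.sqrt_nonneg _), div_eq_mul_inv, mul_comm]
    exact mul_le_mul_of_nonneg_right (inv_anti₀ hl (Real.sqrt_le_sqrt hy)) (norm_nonneg _)
  have hs := (h2.add h1).const_smul (1 / 2 : ℂ)
  have e : l2pair I F (stBar Y m) = l2pair I (fun y => F y / (√(ρ y) : ℂ))
      ((1 / 2 : ℂ) • ((fun y => (√(ρ y) : ℂ) * Y (m - 1) y) + fun y => (√(ρ y) : ℂ) * Y m y)) := by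
    refine integral_congr_ae ?_
    filter_upwards [hρ_ge] with y hy
    have hne : (√(ρ y) : ℂ) ≠ 0 :=
      Complex.ofReal_ne_zero.2 (Real.sqrt_pos.2 (hρlow.trans_le hy)).ne'
    simp only [stBar, Pi.smul_apply, Pi.add_apply, smul_eq_mul, map_div₀, map_add, map_mul,
      Complex.conj_ofReal, map_one, map_ofNat]
    field_simp
  rw [e]
  refine (Complex.abs_im_le_norm _).trans ((norm_l2pair_le hFρ hs).trans ?_)
  refine mul_le_mul_of_nonneg_left ?_ (l2norm_nonneg _ _)
  rw [l2norm_eq_norm_toLp hs, l2norm_eq_norm_toLp h1, l2norm_eq_norm_toLp h2,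
    MemLp.toLp_const_smul _ (h2.add h1), MemLp.toLp_add h2 h1, norm_smul]
  have := norm_add_le (h2.toLp _) (h1.toLp _)
  rw [show ‖(1 / 2 : ℂ)‖ = 1 / 2 by simp]
  linarith

lemma memLp_top_sqrt {ρ : ℝ → ℝ} (hρ : MemLp ρ ⊤ volume) :
    MemLp (fun y => √(ρ y)) ⊤ volume := by
  refine ((memLp_top_const (1 : ℝ)).add hρ.norm).of_le
    (Real.continuous_sqrt.comp_aestronglyMeasurable hρ.1) (Filter.Eventually.of_forall fun y => ?_)
  simp only [Pi.add_apply]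
  rw [Real.norm_of_nonneg (Real.sqrt_nonneg _), Real.norm_of_nonneg (by positivity), Real.norm_eq_abs]
  refine Real.sqrt_le_iff.2 ⟨by positivity, ?_⟩
  nlinarith [le_abs_self (ρ y), abs_nonneg (ρ y)]

/-- An essential lower bound of `ρ` bounds its value at infinity, as that value is attained on a
set of positive measure. -/
lemma le_value_at_infinity {ρ : ℝ → ℝ} {ρlow ρi X₀ : ℝ} (hρ_ge : ∀ᵐ y, ρlow ≤ ρ y)
    (hinf : ∀ᵐ y, X₀ ≤ |y| → ρ y = ρi) : ρlow ≤ ρi := by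
  have h : ∃ᵐ y ∂(volume : Measure ℝ), y ∈ Ioi X₀ := by
    rw [frequently_ae_mem_iff]
    simp
  obtain ⟨y, hy, h1, h2⟩ := (h.and_eventually (hρ_ge.and hinf)).exists
  rw [← h2 (le_trans (le_of_lt hy) (le_abs_self y))]
  exact h1

end SchrodingerFEM

theorem proposition1
    -- coefficients
    (ħ : ℝ) (hħ : 0 < ħ) (ρ B V : ℝ → ℝ)
    (hρ : MemLp ρ ⊤ volume) (hB : MemLp B ⊤ volume) (hV : MemLp V ⊤ volume)
    (ρlow Blow : ℝ) (hρlow : 0 < ρlow) (hBlow : 0 < Blow)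
    (hρ_ge : ∀ᵐ y, ρlow ≤ ρ y) (hB_ge : ∀ᵐ y, Blow ≤ B y)
    (X₀ X : ℝ) (hX₀ : 0 < X₀) (hX : X₀ < X) (ρi Bi Vi : ℝ)
    (hinf : ∀ᵐ y, X₀ ≤ |y| → ρ y = ρi ∧ B y = Bi ∧ V y = Vi)
    -- mesh in space
    (x : ℤ → ℝ) (hx : StrictMono x) (J : ℤ) (hJ : x J = X) (hJ' : x (-J) = -X)
    (hxl : x (-J + 1) ≤ -X₀) (hxr : X₀ ≤ x (J - 1))
    (h : ℝ) (hh : ∀ j : ℤ, j ≤ -J + 1 ∨ J ≤ j → x j - x (j - 1) = h)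
    (n : ℕ) (hn : 1 ≤ n)
    -- mesh in time
    (T : ℝ) (hT : 0 < T) (M : ℕ) (hM : 1 ≤ M) (τ : ℝ) (hτ : τ = T / M)
    -- source and solution
    (F : ℕ → ℝ → ℂ)
    (hF : ∀ m, 1 ≤ m → m ≤ M → MemLp (F m) 2 (volume.restrict (Ioo (-X) X)))
    (Ψ : ℕ → ℝ → ℂ) (hΨX : Ψ 0 X = 0) (hΨX' : Ψ 0 (-X) = 0)
    (hΨ : SchrodingerFEM.IsSchemeSolution n ħ ρ B V ρi Bi Vi x J X h τ M
      (fun m φ => SchrodingerFEM.l2pair (Ioo (-X) X) (F m) φ) Ψ) :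
    ∀ m ≤ M,
      SchrodingerFEM.l2norm (Ioo (-X) X) (fun y => (Real.sqrt (ρ y) : ℂ) * Ψ m y)
        ≤ SchrodingerFEM.l2norm (Ioo (-X) X) (fun y => (Real.sqrt (ρ y) : ℂ) * Ψ 0 y)
          + 2 / ħ * ∑ k ∈ Finset.Icc 1 M,
              SchrodingerFEM.l2norm (Ioo (-X) X) (fun y => F k y / (Real.sqrt (ρ y) : ℂ)) * τ := by
  have hJ0 : x (J - 1) < x J := hx (by omega)
  have hh0 : 0 < h := by rw [← hh J (Or.inr le_rfl)]; linarith
  have hτ0 : 0 < τ := by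
    rw [hτ]
    have : (0 : ℝ) < M := by exact_mod_cast hM
    positivity
  have hρi : 0 ≤ ρi :=
    hρlow.le.trans (SchrodingerFEM.le_value_at_infinity hρ_ge
      (hinf.mono fun y hy h => (hy h).1))
  have hc : SchrodingerFEM.MeshCovers x (Ioc (-J) J) (Ioo (-X) X) := by
    rw [← hJ', ← hJ]
    exact SchrodingerFEM.meshCovers_Ioo hx (-J) J
  have hsqrt := (SchrodingerFEM.memLp_top_sqrt hρ).restrict (Ioo (-X) X)
  have hge := ae_restrict_of_ae (s := Ioo (-X) X) hρ_ge
  set a : ℕ → ℝ := fun m =>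
    SchrodingerFEM.l2norm (Ioo (-X) X) (fun y => (√(ρ y) : ℂ) * Ψ m y) with ha
  set f : ℕ → ℝ := fun m =>
    SchrodingerFEM.l2norm (Ioo (-X) X) (fun y => F m y / (√(ρ y) : ℂ)) with hf
  -- The boundary term at time level `m` for a boundary value sequence `Φ`.
  set b : (ℕ → ℂ) → ℕ → ℝ := fun Φ m => ((ħ : ℂ) ^ 2 / 2 * Bi *
    SchrodingerFEM.dtbcOp n ħ ρi Bi Vi h τ m Φ * conj ((Φ (m - 1) + Φ m) / 2)).im with hb
  have step : ∀ m, 1 ≤ m → m ≤ M → a m ^ 2 - a (m - 1) ^ 2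
      ≤ τ / ħ * f m * (a (m - 1) + a m)
        - 2 * τ / ħ * (b (fun l => Ψ l X) m + b (fun l => Ψ l (-X)) m) := by
    intro m hm hmM
    have m1 := hΨ.mem m hmM
    have m2 := hΨ.mem (m - 1) (by omega)
    have e := congrArg Complex.im
      (hΨ.eqn m hm hmM _ (SchrodingerFEM.stBar_mem_feSpace hc m2 m1))
    have e1 := SchrodingerFEM.re_l2pair_dtBar_stBar (τ := τ) hsqrt
      (hge.mono fun y hy => hρlow.le.trans hy) m1.2.1 m2.2.1
    rw [Complex.add_im, Complex.sub_im, Complex.sub_im, SchrodingerFEM.energyForm_self_im,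
      mul_assoc Complex.I, Complex.I_mul_im, Complex.re_ofReal_mul, e1] at e
    have e2 := (le_abs_self _).trans (SchrodingerFEM.abs_im_l2pair_stBar_le hρlow hge hsqrt
      (hF m hm hmM) m1.2.1 m2.2.1)
    change ħ * ((a m ^ 2 - a (m - 1) ^ 2) / (2 * τ))
      = 0 - b (fun l => Ψ l X) m - b (fun l => Ψ l (-X)) m + _ at e
    change _ ≤ f m * ((a (m - 1) + a m) / 2) at e2
    have e3 : ħ * ((a m ^ 2 - a (m - 1) ^ 2) / (2 * τ)) ≤ f m * ((a (m - 1) + a m) / 2)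
        - (b (fun l => Ψ l X) m + b (fun l => Ψ l (-X)) m) := by linarith
    have e4 := mul_le_mul_of_nonneg_left e3 (by positivity : 0 ≤ 2 * τ / ħ)
    calc a m ^ 2 - a (m - 1) ^ 2
        = 2 * τ / ħ * (ħ * ((a m ^ 2 - a (m - 1) ^ 2) / (2 * τ))) := by field_simp
      _ ≤ _ := e4
      _ = _ := by ring
  have sum_step : ∀ m ≤ M, a m ^ 2 ≤ a 0 ^ 2
      + ∑ k ∈ Finset.Icc 1 m, τ / ħ * f k * (a (k - 1) + a k)
      - 2 * τ / ħ * (∑ k ∈ Finset.Icc 1 m, b (fun l => Ψ l X) k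
        + ∑ k ∈ Finset.Icc 1 m, b (fun l => Ψ l (-X)) k) := by
    intro m
    induction m with
    | zero => simp
    | succ k ih =>
      intro hk
      have h1 := step (k + 1) (by omega) hk
      have h2 := ih (by omega)
      simp only [Finset.sum_Icc_succ_top (Nat.le_add_left 1 k)]
      rw [Nat.add_sub_cancel] at h1 ⊢
      linarith
  intro m hm
  have hfin := SchrodingerFEM.le_add_two_mul_sum_of_sq_le (a := a) (g := fun k => τ / ħ * f k)
    (M := M) (fun m => SchrodingerFEM.l2norm_nonneg _ _)
    (fun m => mul_nonneg (by positivity) (SchrodingerFEM.l2norm_nonneg _ _)) ?_ m hm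
  · refine hfin.trans (le_of_eq ?_)
    congr 1
    rw [Finset.mul_sum, Finset.mul_sum]
    exact Finset.sum_congr rfl fun k _ => by ring
  · intro k hk
    have b1 : 0 ≤ ∑ i ∈ Finset.Icc 1 k, b (fun l => Ψ l X) i :=
      SchrodingerFEM.sum_im_dtbcOp_nonneg hħ hρi hh0 hτ0 hΨX k
    have b2 : 0 ≤ ∑ i ∈ Finset.Icc 1 k, b (fun l => Ψ l (-X)) i :=
      SchrodingerFEM.sum_im_dtbcOp_nonneg hħ hρi hh0 hτ0 hΨX' k
    have hp : 0 ≤ 2 * τ / ħ * (∑ i ∈ Finset.Icc 1 k, b (fun l => Ψ l X) i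
        + ∑ i ∈ Finset.Icc 1 k, b (fun l => Ψ l (-X)) i) :=
      mul_nonneg (by positivity) (add_nonneg b1 b2)
    linarith [sum_step k hk]
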